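/- A fibration of $\mathbb{R}^n$ by affine copies of $\mathbb{R}^k$ is a partition of $\mathbb{R}^n$ into affine $k$-planes, called fibers, such that the linear $k$-plane parallel to the fiber through $x$ depends continuously on $x\in\mathbb{R}^n$, as an element of the Grassmannian of $k$-dimensional linear subspaces of $\mathbb{R}^n$. Such a fibration is (globally) skew if no two distinct fibers contain parallel lines, that is, if any two distinct fibers have no common nonzero direction vector. It is locally skew if every point of $\mathbb{R}^n$ has a neighborhood $V$ such that no two distinct fibers meeting $V$ contain parallel lines. **Theorem.** If a fibration of $\mathbb{R}^n$ by affine copies of $\mathbb{R}^k$ is locally skew, then it is globally skew. -/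

import Mathlib

open scoped Topology

/-- A fibration of Euclidean space `ℝⁿ` by affine copies of `ℝᵏ`, given by the map that sends a
point to the fiber through it. The fibers are affine `k`-planes, they partition `ℝⁿ`, and the
linear `k`-plane parallel to the fiber through `x` depends continuously on `x`. The topology of
the Grassmannian is the usual one: a linear subspace is identified with the orthogonal projection
onto it. -/
structure PlaneFibration (n k : ℕ) where
  /-- the fiber through a point -/
  fiber : EuclideanSpace ℝ (Fin n) → AffineSubspace ℝ (EuclideanSpace ℝ (Fin n))
  mem_fiber : ∀ x, x ∈ fiber x
  fiber_eq_of_mem : ∀ x y, y ∈ fiber x → fiber y = fiber x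
  finrank_direction : ∀ x, Module.finrank ℝ (fiber x).direction = k
  continuous_direction : Continuous fun x =>
    ((fiber x).direction.starProjection :
      EuclideanSpace ℝ (Fin n) →L[ℝ] EuclideanSpace ℝ (Fin n))

/-- Some line in `P` is parallel to (possibly equal to) some line in `Q`. -/
def ContainParallelLines {n : ℕ} (P Q : AffineSubspace ℝ (EuclideanSpace ℝ (Fin n))) : Prop :=
  ∃ l m : AffineSubspace ℝ (EuclideanSpace ℝ (Fin n)),
    Module.finrank ℝ l.direction = 1 ∧ Module.finrank ℝ m.direction = 1 ∧
      l ≤ P ∧ m ≤ Q ∧ l.Parallel m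

/-- For nonempty affine subspaces, containing parallel lines means having a common nonzero
direction vector. -/
theorem containParallelLines_iff {n : ℕ} {P Q : AffineSubspace ℝ (EuclideanSpace ℝ (Fin n))}
    {p q : EuclideanSpace ℝ (Fin n)} (hp : p ∈ P) (hq : q ∈ Q) :
    ContainParallelLines P Q ↔ ∃ w, w ≠ 0 ∧ w ∈ P.direction ∧ w ∈ Q.direction := by
  constructor
  · rintro ⟨l, m, hl, -, hlP, hmQ, hlm⟩
    obtain ⟨w, hw, -⟩ := finrank_eq_one_iff'.1 hl
    refine ⟨w, fun h => hw (Subtype.ext h), AffineSubspace.direction_le hlP w.2, ?_⟩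
    exact AffineSubspace.direction_le hmQ (hlm.direction_eq ▸ w.2)
  · rintro ⟨w, hw, hwP, hwQ⟩
    refine ⟨AffineSubspace.mk' p (ℝ ∙ w), AffineSubspace.mk' q (ℝ ∙ w), ?_, ?_, ?_, ?_, ?_⟩
    · rw [AffineSubspace.direction_mk']; exact finrank_span_singleton hw
    · rw [AffineSubspace.direction_mk']; exact finrank_span_singleton hw
    · rw [← AffineSubspace.mk'_eq hp]
      intro x hx
      rw [AffineSubspace.mem_mk'] at hx ⊢
      exact (Submodule.span_singleton_le_iff_mem w _).2 hwP hx
    · rw [← AffineSubspace.mk'_eq hq]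
      intro x hx
      rw [AffineSubspace.mem_mk'] at hx ⊢
      exact (Submodule.span_singleton_le_iff_mem w _).2 hwQ hx
    · rw [AffineSubspace.parallel_iff_direction_eq_and_eq_bot_iff_eq_bot]
      refine ⟨by simp, ?_⟩
      have h1 := (AffineSubspace.mk'_nonempty p (ℝ ∙ w))
      have h2 := (AffineSubspace.mk'_nonempty q (ℝ ∙ w))
      rw [AffineSubspace.nonempty_iff_ne_bot] at h1 h2
      simp [h1, h2]

namespace PlaneFibration

variable {n k : ℕ}

/-- Globally skew: no two distinct fibers contain parallel lines. -/
def IsSkew (F : PlaneFibration n k) : Prop :=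
  ∀ x y, F.fiber x ≠ F.fiber y → ¬ ContainParallelLines (F.fiber x) (F.fiber y)

/-- Locally skew: every point has a neighborhood such that no two distinct fibers meeting this
neighborhood contain parallel lines. -/
def IsLocallySkew (F : PlaneFibration n k) : Prop :=
  ∀ z, ∃ U ∈ 𝓝 z, ∀ x ∈ U, ∀ y ∈ U, F.fiber x ≠ F.fiber y →
    ¬ ContainParallelLines (F.fiber x) (F.fiber y)

end PlaneFibration

/-!
Let two fibers share a nonzero direction `u`, let `x` lie on the first, and let `p` be the foot on
the second of the perpendicular from `x`. Write `D` for the direction of the fiber through `p`.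
For `a ∈ Dᗮ` small, the direction of the fiber through `p + a` is a graph over `D`, so it contains
a unique vector `u + v a` with `v a ∈ Dᗮ`, and `v` is continuous. If `v a + s (a - b) = 0` with
`s > 0`, then the fiber through `p + a` contains `p + b + u / s`.

* For `b = 0` that point lies on the fiber through `p`, so `a = 0`. If `v a = 0` then `u` is a
  direction at `p + a`, and local skewness gives `a = 0`. Thus `v a + s a ≠ 0` for all `s ≥ 0` and
  all small `a ≠ 0`: on small spheres `v` is homotopic to the identity through nowhere vanishing
  maps.
* Consequently the zero of `v` at `0` survives small perturbations (the Poincaré–Bohl theorem,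
  `ContinuousOn.exists_eq_zero_of_forall_sphere_ne`, in the form
  `ContinuousOn.exists_add_smul_sub_eq_zero`): for some `ε > 0` there is `a` with
  `v a + ε (a - (x - p)) = 0`. Then the fiber through `p + a` contains `x + u / ε`, a point of the
  fiber through `x`. So the fiber through `x` meets every neighborhood of `p`; being closed, it
  contains `p`, and the two fibers agree.

The Poincaré–Bohl theorem is derived from the nonexistence of a continuously differentiable
retraction `r` of the ball onto the sphere, proved by volume: `∫ det (1 + t (Dr - 1))` over the ball
is a polynomial in `t`, equal to the volume of the ball for small `t ≥ 0` because there
`x ↦ x + t (r x - x)` permutes the ball, yet zero for `t = 1`.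
-/

open MeasureTheory Metric Set Polynomial

/-! ### Perturbations of the identity and their determinants -/
/-- Extension by zero from the unit ball preserves a Lipschitz bound for maps vanishing on the
unit sphere: a segment leaving the ball crosses the sphere. -/
theorem LipschitzOnWith.indicator_ball_of_eq_zero_on_sphere {E F : Type*} [NormedAddCommGroup E]
    [NormedSpace ℝ E] [SeminormedAddCommGroup F] {h : E → F} {C : NNReal}
    (hh : LipschitzOnWith C h (closedBall 0 1)) (h0 : ∀ x ∈ sphere (0 : E) 1, h x = 0) :
    LipschitzWith C ((ball (0 : E) 1).indicator h) := by
  -- one point inside the ball, the other outside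
  have key : ∀ x y : E, x ∈ ball (0 : E) 1 → y ∉ ball (0 : E) 1 →
      dist (h x) 0 ≤ C * dist x y := by
    intro x y hx hy
    have hseg : ∃ z ∈ segment ℝ x y, ‖z‖ = 1 := by
      have hc : IsPreconnected (segment ℝ x y) := (convex_segment x y).isPreconnected
      have := hc.intermediate_value (left_mem_segment ℝ x y) (right_mem_segment ℝ x y)
        (f := fun z => ‖z‖) continuous_norm.continuousOn
      refine this ⟨?_, ?_⟩
      · simpa using (mem_ball_zero_iff.1 hx).le
      · simpa using hy
    obtain ⟨z, hz, hz1⟩ := hseg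
    have hzs : z ∈ sphere (0 : E) 1 := by simpa using hz1
    calc dist (h x) 0 = dist (h x) (h z) := by rw [h0 z hzs]
      _ ≤ C * dist x z := hh.dist_le_mul _ (ball_subset_closedBall hx) _
          (sphere_subset_closedBall hzs)
      _ ≤ C * dist x y := by
          gcongr
          have := dist_add_dist_of_mem_segment hz
          linarith [dist_nonneg (x := z) (y := y)]
  refine LipschitzWith.of_dist_le_mul fun x y => ?_
  by_cases hx : x ∈ ball (0 : E) 1 <;> by_cases hy : y ∈ ball (0 : E) 1
  · rw [indicator_of_mem hx, indicator_of_mem hy]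
    exact hh.dist_le_mul _ (ball_subset_closedBall hx) _ (ball_subset_closedBall hy)
  · rw [indicator_of_mem hx, indicator_of_notMem hy]
    exact key x y hx hy
  · rw [indicator_of_notMem hx, indicator_of_mem hy, dist_comm, dist_comm x y]
    exact key y x hy hx
  · rw [indicator_of_notMem hx, indicator_of_notMem hy, dist_self]
    positivity

/-- A perturbation of the identity by a contraction is a bijection. -/
theorem LipschitzWith.bijective_id_add {E : Type*} [NormedAddCommGroup E]
    [CompleteSpace E] {g : E → E} {K : NNReal} (hg : LipschitzWith K g) (hK : K < 1) :
    Function.Bijective fun x => x + g x := by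
  have hc : ∀ y, ContractingWith K fun x => y - g x := fun y =>
    ⟨hK, by simpa using (LipschitzWith.const (β := E) y).sub hg⟩
  constructor
  · intro x x' hxx
    refine (hc (x + g x)).fixedPoint_unique' (x := x) (y := x') ?_ ?_
    · simp [Function.IsFixedPt]
    · have : x + g x = x' + g x' := hxx
      simp [Function.IsFixedPt, this]
  · intro y
    have := (hc y).fixedPoint_isFixedPt
    refine ⟨ContractingWith.fixedPoint _ (hc y), ?_⟩
    rw [Function.IsFixedPt] at this
    exact (sub_eq_iff_eq_add.1 this).symm

/-- A bijection which is the identity off a set maps that set onto itself. -/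
theorem Function.Bijective.image_eq_of_eqOn_compl {α : Type*} {f : α → α}
    (hf : Function.Bijective f) {s : Set α} (hs : ∀ x ∉ s, f x = x) : f '' s = s := by
  ext y
  constructor
  · rintro ⟨x, hx, rfl⟩
    by_contra hy
    rw [hf.1 (hs _ hy)] at hy
    exact hy hx
  · intro hy
    obtain ⟨x, rfl⟩ := hf.2 y
    refine ⟨x, ?_, rfl⟩
    by_contra hx
    rw [hs x hx] at hy
    exact hx hy

theorem ContinuousLinearMap.det_one_add_pos {E : Type*} [NormedAddCommGroup E] [NormedSpace ℝ E]
    [FiniteDimensional ℝ E] {A : E →L[ℝ] E} (hA : ‖A‖ < 1) :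
    0 < (1 + A).det := by
  have hne : ∀ t ∈ Icc (0 : ℝ) 1, (1 + t • A).det ≠ 0 := by
    intro t ht h0
    have hlt : ‖-(t • A)‖ < 1 := by
      rw [norm_neg, norm_smul, Real.norm_of_nonneg ht.1]
      nlinarith [ht.1, ht.2, norm_nonneg A]
    have hu : IsUnit (1 - -(t • A)) := isUnit_one_sub_of_norm_lt_one hlt
    rw [sub_neg_eq_add] at hu
    obtain ⟨v, hv⟩ := hu.exists_right_inv
    have hd := congrArg (fun B : E →L[ℝ] E => LinearMap.det (B : E →ₗ[ℝ] E)) hv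
    rw [ContinuousLinearMap.det] at h0
    simp only [ContinuousLinearMap.toLinearMap_mul, map_mul, h0, zero_mul] at hd
    simp at hd
  have hcont : Continuous fun t : ℝ => (1 + t • A).det :=
    ContinuousLinearMap.continuous_det.comp (by fun_prop)
  by_contra hle
  push Not at hle
  obtain ⟨t, ht, h0⟩ := intermediate_value_Icc' (zero_le_one' ℝ) hcont.continuousOn
    (show (0 : ℝ) ∈ _ from ⟨by simpa using hle, by simp [ContinuousLinearMap.det]⟩)
  exact hne t ht h0

/-- `t ↦ det (1 + t A)` is a polynomial of degree at most the dimension, so its value at `1` is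
given by Lagrange interpolation from any `finrank + 1` nodes. -/
theorem ContinuousLinearMap.det_one_add_eq_sum_lagrange {E : Type*} [NormedAddCommGroup E]
    [NormedSpace ℝ E] [FiniteDimensional ℝ E] (A : E →L[ℝ] E) {s : Finset ℝ}
    (hs : Module.finrank ℝ E < s.card) :
    (1 + A).det = ∑ t ∈ s, (1 + t • A).det * (Lagrange.basis s id t).eval 1 := by
  classical
  let b := Module.finBasis ℝ E
  let M := LinearMap.toMatrix b b (A : E →ₗ[ℝ] E)
  let P : ℝ[X] := ((X : ℝ[X]) • M.map C + (1 : Matrix _ _ ℝ).map C).det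
  have hP : ∀ t : ℝ, P.eval t = (1 + t • A).det := by
    intro t
    rw [ContinuousLinearMap.det, ← LinearMap.det_toMatrix b]
    change (Polynomial.evalRingHom t) _ = _
    rw [RingHom.map_det]
    congr 1
    ext i j
    simp [M, Matrix.one_apply, LinearMap.toMatrix_apply, add_comm, Finsupp.single_apply]
    split_ifs <;> simp_all [mul_comm, eq_comm]
  have hdeg : P.degree < s.card := by
    refine lt_of_le_of_lt Polynomial.degree_le_natDegree ?_
    have := Polynomial.natDegree_det_X_add_C_le M 1
    rw [Fintype.card_fin] at this
    exact_mod_cast this.trans_lt hs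
  have hI := Lagrange.eq_interpolate (v := (id : ℝ → ℝ)) (s := s)
    (Function.injective_id.injOn) hdeg
  have h1 := hP 1
  rw [one_smul] at h1
  rw [← h1]
  conv_lhs => rw [hI]
  rw [Lagrange.interpolate_apply, Polynomial.eval_finsetSum]
  refine Finset.sum_congr rfl fun t _ => ?_
  rw [Polynomial.eval_mul, Polynomial.eval_C, id, hP]

/-! ### No retraction onto the sphere, and the Poincaré–Bohl theorem -/

section PoincareBohl

variable {E : Type*} [NormedAddCommGroup E] [InnerProductSpace ℝ E] [FiniteDimensional ℝ E]

/-- If `h` vanishes on the unit sphere then for small `t` the map `x ↦ x + t h x` permutes the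
unit ball, so the integral of its Jacobian determinant is the volume of the ball. -/
theorem setIntegral_det_one_add_smul_fderiv [MeasurableSpace E] [BorelSpace E] (μ : Measure E)
    [μ.IsAddHaarMeasure] {h : E → E} (hd : Differentiable ℝ h) {C : NNReal}
    (hh : LipschitzOnWith C h (closedBall 0 1)) (h0 : ∀ x ∈ sphere (0 : E) 1, h x = 0)
    {t : ℝ} (ht : 0 ≤ t) (htC : t * C < 1) :
    ∫ x in ball (0 : E) 1, (1 + t • fderiv ℝ h x).det ∂μ = μ.real (ball (0 : E) 1) := by
  have hlip := hh.indicator_ball_of_eq_zero_on_sphere h0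
  have hlip' : LipschitzWith (t.toNNReal * C) fun x => t • (ball (0 : E) 1).indicator h x := by
    refine LipschitzWith.of_dist_le_mul fun x y => ?_
    rw [dist_smul₀, NNReal.coe_mul, Real.coe_toNNReal t ht, Real.norm_of_nonneg ht, mul_assoc]
    gcongr
    exact hlip.dist_le_mul x y
  have hK : t.toNNReal * C < 1 := by
    rw [← NNReal.coe_lt_coe, NNReal.coe_mul, Real.coe_toNNReal t ht]; exact_mod_cast htC
  have hbij := hlip'.bijective_id_add hK
  have himg := hbij.image_eq_of_eqOn_compl (s := ball (0 : E) 1) fun x hx => by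
    simp [indicator_of_notMem hx]
  have hderiv : ∀ x ∈ ball (0 : E) 1, HasFDerivWithinAt
      (fun x => x + t • (ball (0 : E) 1).indicator h x) (1 + t • fderiv ℝ h x)
      (ball (0 : E) 1) x := by
    intro x hx
    have h1 : HasFDerivAt (fun x => x + t • h x) (1 + t • fderiv ℝ h x) x :=
      (hasFDerivAt_id x).add ((hd x).hasFDerivAt.const_smul t)
    refine h1.hasFDerivWithinAt.congr (fun y hy => ?_) ?_
    · simp only [indicator_of_mem hy]
    · simp only [indicator_of_mem hx]
  have hvol := lintegral_abs_det_fderiv_eq_addHaar_image μ measurableSet_ball hderiv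
    hbij.1.injOn
  rw [himg] at hvol
  have hpos : ∀ x ∈ ball (0 : E) 1, 0 < (1 + t • fderiv ℝ h x).det := by
    intro x hx
    refine ContinuousLinearMap.det_one_add_pos ?_
    have hb : ‖fderiv ℝ h x‖ ≤ C := norm_fderiv_le_of_lipschitzOn ℝ
      (closedBall_mem_nhds_of_mem hx) hh
    rw [norm_smul, Real.norm_of_nonneg ht]
    exact (mul_le_mul_of_nonneg_left hb ht).trans_lt htC
  rw [measureReal_def, ← hvol, integral_eq_lintegral_of_nonneg_ae]
  · congr 1
    refine setLIntegral_congr_fun measurableSet_ball fun x hx => ?_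
    simp only [abs_of_pos (hpos x hx)]
  · exact (ae_restrict_mem measurableSet_ball).mono fun x hx => (hpos x hx).le
  · exact (ContinuousLinearMap.continuous_det.measurable.comp
      (((measurable_fderiv ℝ h).const_smul t).const_add 1)).aestronglyMeasurable

/-- There is no continuously differentiable retraction of the unit ball onto the unit sphere.
With `h x = r x - x`, the integral over the ball of `det (1 + t • Dh)` is a polynomial in `t` which
equals the volume of the ball for small `t`, hence also for `t = 1`. There the integrand is
`det Dr`, which vanishes because the values of `r` lie on the sphere. -/
theorem not_exists_contDiff_retraction_sphere {r : E → E} (hr : ContDiff ℝ 1 r)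
    (hr1 : ∀ x ∈ closedBall (0 : E) 1, ‖r x‖ = 1) (hrs : ∀ x ∈ sphere (0 : E) 1, r x = x) :
    False := by
  borelize E
  let μ : Measure E := Measure.addHaar
  set h : E → E := fun x => r x - x with hdef
  have hC1 : ContDiff ℝ 1 h := hr.sub contDiff_id
  have hd : Differentiable ℝ h := hC1.differentiable one_ne_zero
  have h0 : ∀ x ∈ sphere (0 : E) 1, h x = 0 := fun x hx => sub_eq_zero.2 (hrs x hx)
  have hcf : Continuous (fderiv ℝ h) := hC1.continuous_fderiv one_ne_zero
  obtain ⟨C, hC⟩ : ∃ C : NNReal, LipschitzOnWith C h (closedBall 0 1) := by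
    obtain ⟨C, hC⟩ := (isCompact_closedBall (0 : E) 1).exists_bound_of_continuousOn
      hcf.continuousOn
    refine ⟨C.toNNReal, (convex_closedBall (0 : E) 1).lipschitzOnWith_of_nnnorm_fderiv_le
      (fun x _ => hd x) fun x hx => ?_⟩
    rw [← NNReal.coe_le_coe, coe_nnnorm]
    exact (hC x hx).trans (Real.le_coe_toNNReal C)
  have hdet : ∀ x ∈ ball (0 : E) 1, (1 + fderiv ℝ h x).det = 0 := by
    intro x hx
    have hDr : (1 + fderiv ℝ h x) = fderiv ℝ r x := by
      have : fderiv ℝ h x = fderiv ℝ r x - 1 := by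
        exact ((hr.differentiable one_ne_zero x).hasFDerivAt.sub (hasFDerivAt_id x)).fderiv
      rw [this]; abel
    rw [hDr]
    by_contra hne
    have hsurj : Function.Surjective (fderiv ℝ r x) := by
      exact (LinearMap.equivOfDetNeZero (fderiv ℝ r x : E →ₗ[ℝ] E) hne).surjective
    have hin : ∀ w, inner ℝ (r x) (fderiv ℝ r x w) = 0 := by
      intro w
      have hra := (hr.differentiable one_ne_zero x).hasFDerivAt
      have h1 := hra.norm_sq
      have h2 : HasFDerivAt (fun y => ‖r y‖ ^ 2) (0 : E →L[ℝ] ℝ) x := by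
        refine (hasFDerivAt_const (1 : ℝ) x).congr_of_eventuallyEq ?_
        filter_upwards [closedBall_mem_nhds_of_mem hx] with y hy
        simp [hr1 y hy]
      have := congrArg (fun L : E →L[ℝ] ℝ => L w) (h1.unique h2)
      simpa using this
    obtain ⟨w, hw⟩ := hsurj (r x)
    have := hin w
    rw [hw, inner_self_eq_zero] at this
    have h1 := hr1 x (ball_subset_closedBall hx)
    rw [this, norm_zero] at h1
    exact zero_ne_one h1
  -- interpolation nodes `t` with `0 ≤ t` and `t * C < 1`
  obtain ⟨s, hs, hcard⟩ := (Ioo_infinite (a := (0 : ℝ)) (b := 1 / (C + 1))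
    (by positivity)).exists_subset_card_eq (Module.finrank ℝ E + 1)
  have hnode : ∀ t ∈ s, 0 ≤ t ∧ t * C < 1 := by
    intro t ht
    obtain ⟨h1, h2⟩ := hs ht
    rw [lt_div_iff₀ (by positivity)] at h2
    exact ⟨h1.le, by nlinarith⟩
  have hint : ∀ t : ℝ, IntegrableOn (fun x => (1 + t • fderiv ℝ h x).det) (ball (0 : E) 1) μ := by
    intro t
    have hc : Continuous fun x => (1 + t • fderiv ℝ h x).det :=
      ContinuousLinearMap.continuous_det.comp (by fun_prop)
    exact (hc.continuousOn.integrableOn_compact (isCompact_closedBall (0 : E) 1)).mono_set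
      ball_subset_closedBall
  have hzero : ∫ x in ball (0 : E) 1, (1 + fderiv ℝ h x).det ∂μ = 0 :=
    setIntegral_eq_zero_of_forall_eq_zero hdet
  have hsum : ∫ x in ball (0 : E) 1, (1 + fderiv ℝ h x).det ∂μ = μ.real (ball (0 : E) 1) := by
    rw [funext fun x => ContinuousLinearMap.det_one_add_eq_sum_lagrange (fderiv ℝ h x)
      (show Module.finrank ℝ E < s.card by omega)]
    rw [integral_finsetSum _ fun t _ => (hint t).mul_const _]
    have hb : ∑ t ∈ s, (Lagrange.basis s id t).eval (1 : ℝ) = 1 := by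
      rw [← Polynomial.eval_finsetSum, Lagrange.sum_basis Function.injective_id.injOn
        (Finset.card_pos.1 (by omega)), Polynomial.eval_one]
    calc _ = ∑ t ∈ s, μ.real (ball (0 : E) 1) * (Lagrange.basis s id t).eval (1 : ℝ) := by
          refine Finset.sum_congr rfl fun t ht => ?_
          rw [integral_mul_const, setIntegral_det_one_add_smul_fderiv μ hd hC h0 (hnode t ht).1
            (hnode t ht).2]
      _ = _ := by rw [← Finset.mul_sum, hb, mul_one]
  have hpos : 0 < μ.real (ball (0 : E) 1) :=
    ENNReal.toReal_pos (measure_ball_pos μ _ one_pos).ne' measure_ball_lt_top.ne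
  rw [hsum] at hzero
  exact hpos.ne' hzero

/-- A continuous self-map of a Euclidean space that is the identity outside the ball of radius
`1 / 2` has a zero. Smoothing a nowhere vanishing such map without changing it near the unit sphere
and normalizing would give a retraction onto the sphere. -/
theorem exists_eq_zero_of_eq_self_of_half_le_norm {g : E → E} (hg : Continuous g)
    (hid : ∀ x, 1 / 2 ≤ ‖x‖ → g x = x) : ∃ x, g x = 0 := by
  by_contra! hne
  have hS : IsClosed {x : E | 3 / 4 ≤ ‖x‖} := isClosed_le continuous_const continuous_norm
  have hU : IsOpen {x : E | 1 / 2 < ‖x‖} := isOpen_lt continuous_const continuous_norm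
  have hsub : {x : E | 3 / 4 ≤ ‖x‖} ⊆ {x : E | 1 / 2 < ‖x‖} := fun x hx => by
    simp only [mem_ofPred_eq] at hx ⊢; linarith
  obtain ⟨f, hf, hdist, heq, -⟩ := hg.exists_contDiff_approx_and_eqOn 1
    (ε := fun x => ‖g x‖) hg.norm (fun x => norm_pos_iff.2 (hne x)) hS
    (hU.mem_nhdsSet.2 hsub) (contDiffOn_id.congr fun x hx => hid x (le_of_lt hx))
  have hf0 : ∀ x, f x ≠ 0 := by
    intro x hx
    have := hdist x
    rw [hx, dist_zero_left] at this
    exact lt_irrefl _ this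
  refine not_exists_contDiff_retraction_sphere (r := fun x => ‖f x‖⁻¹ • f x)
    (((hf.norm ℝ hf0).inv fun x => norm_ne_zero_iff.2 (hf0 x)).smul hf) ?_ ?_
  · intro x _
    simp [norm_smul, hf0 x]
  · intro x hx
    have hx1 : ‖x‖ = 1 := by simpa using hx
    have : f x = x := by
      rw [heq (show 3 / 4 ≤ ‖x‖ by rw [hx1]; norm_num)]
      exact hid x (by rw [hx1]; norm_num)
    simp [this, hx1]

/-- The **Poincaré–Bohl theorem**: a continuous map on a closed ball which, at points `x` of the
boundary sphere, is never a multiple `-s • x` with `s ≥ 0` has a zero. The map is extended by a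
radial interpolation with the identity, which creates no new zeros. -/
theorem ContinuousOn.exists_eq_zero_of_forall_sphere_ne {R : ℝ} (hR : 0 < R) {G : E → E}
    (hG : ContinuousOn G (closedBall 0 R))
    (hs : ∀ x ∈ sphere (0 : E) R, ∀ s : ℝ, 0 ≤ s → G x + s • x ≠ 0) :
    ∃ x ∈ closedBall (0 : E) R, G x = 0 := by
  -- radial projection to the ball, and a weight rising from `0` at radius `R` to `1` at `2 R`
  let π : E → E := fun x => (R / max R ‖x‖) • x
  let τ : E → ℝ := fun x => min 1 (max 0 (‖x‖ / R - 1))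
  have hmax : ∀ x : E, 0 < max R ‖x‖ := fun x => lt_max_of_lt_left hR
  have hπc : Continuous π := (continuous_const.div (by fun_prop) fun x => (hmax x).ne').smul
    continuous_id
  have hπ : ∀ x, π x ∈ closedBall (0 : E) R := by
    intro x
    rw [mem_closedBall_zero_iff, norm_smul, Real.norm_of_nonneg (by have := hmax x; positivity),
      div_mul_eq_mul_div, div_le_iff₀ (hmax x)]
    gcongr
    exact le_max_right _ _
  have hτc : Continuous τ := by fun_prop
  have hF : Continuous fun x => (1 - τ x) • G (π x) + τ x • x := by
    have : Continuous fun x => G (π x) := hG.comp_continuous hπc hπ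
    exact ((continuous_const.sub hτc).smul this).add (hτc.smul continuous_id)
  -- rescale so that the map is the identity outside the ball of radius `1 / 2`
  obtain ⟨y, hy⟩ := exists_eq_zero_of_eq_self_of_half_le_norm
    (g := fun y => (4 * R)⁻¹ • ((1 - τ ((4 * R) • y)) • G (π ((4 * R) • y))
      + τ ((4 * R) • y) • ((4 * R) • y)))
    ((hF.comp (continuous_const_smul (4 * R))).const_smul _) (by
      intro y hy
      have hτ1 : τ ((4 * R) • y) = 1 := by
        have : 1 ≤ ‖(4 * R) • y‖ / R - 1 := by
          rw [norm_smul, Real.norm_of_nonneg (by positivity), le_sub_iff_add_le,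
            le_div_iff₀ hR]
          nlinarith
        exact min_eq_left (le_max_of_le_right this)
      rw [hτ1]
      rw [sub_self, zero_smul, zero_add, one_smul, inv_smul_smul₀ (by positivity)])
  set x : E := (4 * R) • y with hx
  have hx0 : (1 - τ x) • G (π x) + τ x • x = 0 :=
    (smul_eq_zero.1 hy).resolve_left (by positivity)
  rcases le_or_gt ‖x‖ R with hle | hlt
  · have h1 : τ x = 0 := by
      have : ‖x‖ / R - 1 ≤ 0 := by rw [sub_nonpos, div_le_one hR]; exact hle
      simp [τ, max_eq_left this]
    have h2 : π x = x := by simp [π, max_eq_left hle, hR.ne']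
    rw [h1, h2] at hx0
    exact ⟨x, by simpa using hle, by simpa using hx0⟩
  · exfalso
    have hxpos : 0 < ‖x‖ := hR.trans hlt
    have hπx : π x = (R / ‖x‖) • x := by simp [π, max_eq_right hlt.le]
    have hxπ : x = (‖x‖ / R) • π x := by
      rw [hπx, smul_smul, div_mul_div_cancel₀ hR.ne', div_self hxpos.ne', one_smul]
    have hsph : π x ∈ sphere (0 : E) R := by
      rw [mem_sphere_zero_iff_norm, hπx, norm_smul, Real.norm_of_nonneg (by positivity),
        div_mul_cancel₀ _ hxpos.ne']
    have hτle : τ x ≤ 1 := min_le_left _ _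
    rcases hτle.eq_or_lt with h1 | h1
    · rw [h1] at hx0
      have : x = 0 := by simpa using hx0
      rw [this, norm_zero] at hxpos
      exact lt_irrefl _ hxpos
    · have hτ0 : 0 ≤ τ x := le_min zero_le_one (le_max_left _ _)
      have h1' : 0 < 1 - τ x := sub_pos.2 h1
      refine hs (π x) hsph ((1 - τ x)⁻¹ * (τ x * (‖x‖ / R))) (by positivity) ?_
      have h3 := congrArg (fun z => (1 - τ x)⁻¹ • z) hx0
      simp only [smul_add, smul_smul, smul_zero, inv_mul_cancel₀ h1'.ne', one_smul] at h3
      rw [← h3, ← mul_assoc, mul_smul _ (‖x‖ / R), ← hxπ]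

/-- Stability of the zero given by the Poincaré–Bohl theorem: the boundary condition is open, so a
small multiple of the field `a ↦ a - c` can be added. -/
theorem ContinuousOn.exists_add_smul_sub_eq_zero {R : ℝ} (hR : 0 < R) {v : E → E}
    (hv : ContinuousOn v (closedBall 0 R))
    (hs : ∀ a ∈ sphere (0 : E) R, ∀ s : ℝ, 0 ≤ s → v a + s • a ≠ 0) (c : E) :
    ∃ ε : ℝ, 0 < ε ∧ ∃ a ∈ closedBall (0 : E) R, v a + ε • (a - c) = 0 := by
  have hne : ∀ q ∈ sphere (0 : E) R ×ˢ Icc (0 : ℝ) 1, 0 < ‖(1 - q.2) • v q.1 + q.2 • q.1‖ := by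
    rintro ⟨a, t⟩ ⟨ha, ht0, ht1⟩
    simp only at ha ht0 ht1 ⊢
    refine norm_pos_iff.2 fun h => ?_
    rcases ht1.eq_or_lt with rfl | ht1
    · have : a = 0 := by simpa using h
      rw [this, mem_sphere_zero_iff_norm, norm_zero] at ha
      exact hR.ne ha
    · have h1 : 0 < 1 - t := sub_pos.2 ht1
      refine hs a ha ((1 - t)⁻¹ * t) (by positivity) ?_
      have := congrArg (fun z => (1 - t)⁻¹ • z) h
      simpa only [smul_add, smul_smul, smul_zero, inv_mul_cancel₀ h1.ne', one_smul] using this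
  have hcont : ContinuousOn (fun q : E × ℝ => ‖(1 - q.2) • v q.1 + q.2 • q.1‖)
      (sphere (0 : E) R ×ˢ Icc (0 : ℝ) 1) := by
    have : ContinuousOn (fun q : E × ℝ => v q.1) (sphere (0 : E) R ×ˢ Icc (0 : ℝ) 1) :=
      (hv.mono sphere_subset_closedBall).comp continuousOn_fst fun q hq => hq.1
    exact (((continuousOn_const.sub continuousOn_snd).smul this).add
      (continuousOn_snd.smul continuousOn_fst)).norm
  obtain ⟨δ, hδ, hmin⟩ := ((isCompact_sphere (0 : E) R).prod isCompact_Icc).exists_forall_le'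
    hcont hne
  have hε : 0 < δ / (‖c‖ + 1) := by positivity
  set ε := δ / (‖c‖ + 1) with hεd
  have hεc : ε * ‖c‖ < δ := by
    rw [hεd, div_mul_eq_mul_div, div_lt_iff₀ (by positivity)]
    nlinarith
  refine ⟨ε, hε, ContinuousOn.exists_eq_zero_of_forall_sphere_ne hR (by fun_prop) ?_⟩
  intro a ha s hs0 h
  -- dividing by `1 + ε + s` makes the coefficients of `v a` and `a` add up to one
  have hk : 0 < 1 + ε + s := by positivity
  have hle := hmin (a, (ε + s) / (1 + ε + s))
    ⟨ha, by positivity, (div_le_one hk).2 (by linarith)⟩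
  have heq : (1 - (ε + s) / (1 + ε + s)) • v a + ((ε + s) / (1 + ε + s)) • a
      = (1 + ε + s)⁻¹ • (ε • c) := by
    have h1 : 1 - (ε + s) / (1 + ε + s) = (1 + ε + s)⁻¹ := by field_simp; ring
    have h2 : v a = ε • c - (ε + s) • a := by
      rw [← sub_eq_zero, ← h]; module
    rw [h1, h2, div_eq_inv_mul]
    module
  simp only [heq, norm_smul, norm_inv, Real.norm_of_nonneg hk.le, Real.norm_of_nonneg hε.le] at hle
  have : (1 + ε + s)⁻¹ * (ε * ‖c‖) ≤ ε * ‖c‖ :=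
    mul_le_of_le_one_left (by positivity) (inv_le_one_of_one_le₀ (by linarith))
  linarith

end PoincareBohl

/-! ### Nearby subspaces as graphs -/

section Graph

variable {V : Type*} [NormedAddCommGroup V] [InnerProductSpace ℝ V] [FiniteDimensional ℝ V]

/-- If the orthogonal projections onto `D` and `D'` are close, then `D'` is a graph over `D`: the
operator `1 + P - P'` is invertible, and its inverse carries `u ∈ D` to the vector of `D'` above
`u`. -/
theorem Submodule.inverse_one_add_starProjection_sub (D D' : Submodule ℝ V)
    (h : ‖D.starProjection - D'.starProjection‖ < 1) {u : V} (hu : u ∈ D) :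
    Ring.inverse (1 + (D.starProjection - D'.starProjection)) u ∈ D' ∧
      D.starProjection (Ring.inverse (1 + (D.starProjection - D'.starProjection)) u) = u := by
  have hunit : IsUnit (1 + (D.starProjection - D'.starProjection)) := by
    have := isUnit_one_sub_of_norm_lt_one (x := -(D.starProjection - D'.starProjection))
      (by rwa [norm_neg])
    rwa [sub_neg_eq_add] at this
  set w := Ring.inverse (1 + (D.starProjection - D'.starProjection)) u
  have hw : w + (D.starProjection w - D'.starProjection w) = u := by
    have := congrArg (fun B : V →L[ℝ] V => B u) (Ring.mul_inverse_cancel _ hunit)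
    simpa using this
  -- `r = w - P' w` lies in `D` and is orthogonal to `D'`, so it is fixed by `P - P'`
  have hr : w - D'.starProjection w = 0 := by
    set r := w - D'.starProjection w with hrd
    have hrD : r ∈ D := by
      have : r = u - D.starProjection w := by rw [hrd, ← hw]; abel
      rw [this]
      exact D.sub_mem hu (D.starProjection_apply_mem w)
    have hrD' : r ∈ D'ᗮ := D'.sub_starProjection_mem_orthogonal w
    have hfix : (D.starProjection - D'.starProjection) r = r := by
      rw [sub_apply, Submodule.starProjection_eq_self_iff.2 hrD,
        (D'.starProjection_apply_eq_zero_iff).2 hrD', sub_zero]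
    by_contra hne
    have := (D.starProjection - D'.starProjection).le_opNorm r
    rw [hfix] at this
    nlinarith [norm_pos_iff.2 hne]
  have hw' : w = D'.starProjection w := sub_eq_zero.1 hr
  constructor
  · rw [hw']; exact D'.starProjection_apply_mem w
  · rw [← hw'] at hw
    simpa using hw

end Graph

/-! ### Fibers with a common direction -/

namespace PlaneFibration

variable {n k : ℕ}

theorem fiber_eq_of_mem_of_mem (F : PlaneFibration n k) {x y z : EuclideanSpace ℝ (Fin n)}
    (hx : z ∈ F.fiber x) (hy : z ∈ F.fiber y) : F.fiber x = F.fiber y :=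
  (F.fiber_eq_of_mem _ _ hx).symm.trans (F.fiber_eq_of_mem _ _ hy)

theorem add_mem_fiber (F : PlaneFibration n k) (x : EuclideanSpace ℝ (Fin n))
    {d : EuclideanSpace ℝ (Fin n)} (hd : d ∈ (F.fiber x).direction) : x + d ∈ F.fiber x := by
  rw [add_comm]
  exact AffineSubspace.vadd_mem_of_mem_direction hd (F.mem_fiber x)

/-- For a locally skew fibration, fibers sharing the nonzero direction `u` coincide, provided the
two points are joined by a vector orthogonal to the fiber through one of them. -/
theorem IsLocallySkew.fiber_eq_of_sub_mem_orthogonal {F : PlaneFibration n k}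
    (hF : F.IsLocallySkew) {x p u : EuclideanSpace ℝ (Fin n)} (hu0 : u ≠ 0)
    (hux : u ∈ (F.fiber x).direction) (hup : u ∈ (F.fiber p).direction)
    (hxp : x - p ∈ (F.fiber p).directionᗮ) : F.fiber x = F.fiber p := by
  by_contra hne
  have hpx : p ∉ F.fiber x := fun h => hne (F.fiber_eq_of_mem _ _ h).symm
  obtain ⟨U, hU, hskew⟩ := hF p
  let D := (F.fiber p).direction
  let P : EuclideanSpace ℝ (Fin n) → EuclideanSpace ℝ (Fin n) →L[ℝ] EuclideanSpace ℝ (Fin n) :=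
    fun q => (F.fiber q).direction.starProjection
  have hP : Continuous P := F.continuous_direction
  have hnear : ∀ᶠ q in 𝓝 p, q ∈ U ∧ ‖P p - P q‖ < 1 ∧ q ∉ F.fiber x := by
    refine Filter.Eventually.and hU (Filter.Eventually.and ?_ ?_)
    · have : Continuous fun q => ‖P p - P q‖ := by fun_prop
      exact this.continuousAt.eventually_lt_const (by simp)
    · exact (F.fiber x).closed_of_finiteDimensional.isOpen_compl.eventually_mem hpx
  obtain ⟨R, hR, hball⟩ := nhds_basis_closedBall.eventually_iff.1 hnear
  have hloc : ∀ a ∈ closedBall (0 : Dᗮ) R,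
      p + a ∈ U ∧ ‖P p - P (p + a)‖ < 1 ∧ p + a ∉ F.fiber x := by
    intro a ha
    refine hball ?_
    simpa using ha
  -- `u + v a` is the direction vector at `p + a` whose projection to the fiber at `p` is `u`
  let w : Dᗮ → EuclideanSpace ℝ (Fin n) := fun a => Ring.inverse (1 + (P p - P (p + a))) u
  let v : Dᗮ → Dᗮ := fun a => Dᗮ.orthogonalProjectionOnto (w a)
  have hwv : ∀ a ∈ closedBall (0 : Dᗮ) R,
      u + v a ∈ (F.fiber (p + a)).direction := by
    intro a ha
    obtain ⟨h1, h2⟩ := D.inverse_one_add_starProjection_sub (F.fiber (p + a)).direction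
      (hloc a ha).2.1 hup
    have h3 : u + v a = w a := by
      have := D.starProjection_add_starProjection_orthogonal (w a)
      rwa [show D.starProjection (w a) = u from h2] at this
    rw [h3]
    exact h1
  have hv : ContinuousOn v (closedBall 0 R) := by
    intro a ha
    have hunit : IsUnit (1 + (P p - P (p + a))) := by
      have := isUnit_one_sub_of_norm_lt_one (x := -(P p - P (p + a)))
        (by rw [norm_neg]; exact (hloc a ha).2.1)
      rwa [sub_neg_eq_add] at this
    have hT : Continuous fun a : Dᗮ => 1 + (P p - P (p + a)) := by fun_prop
    obtain ⟨T, hTu⟩ := hunit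
    have hinv := NormedRing.inverse_continuousAt T
    rw [hTu] at hinv
    have hw : ContinuousAt w a :=
      (ContinuousAt.comp (f := fun a : Dᗮ => 1 + (P p - P (p + a))) hinv
        hT.continuousAt).clm_apply continuousAt_const
    exact (Dᗮ.orthogonalProjectionOnto.continuous.continuousAt.comp hw).continuousWithinAt
  -- a solution of `v a + s (a - b) = 0` puts the point `p + b + u / s` on the fiber through `p + a`
  have hmem : ∀ a ∈ closedBall (0 : Dᗮ) R, ∀ b : Dᗮ, ∀ s : ℝ, 0 < s → v a + s • (a - b) = 0 →
      p + b + s⁻¹ • u ∈ F.fiber (p + a) := by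
    intro a ha b s hs h
    have h1 : (v a : EuclideanSpace ℝ (Fin n)) + s • (a - b : EuclideanSpace ℝ (Fin n)) = 0 := by
      exact_mod_cast congrArg Subtype.val h
    have h2 : p + b + s⁻¹ • u = p + a + s⁻¹ • (u + v a) := by
      rw [eq_neg_of_add_eq_zero_left h1, smul_add, smul_neg, inv_smul_smul₀ hs.ne']
      abel
    rw [h2]
    exact F.add_mem_fiber _ (Submodule.smul_mem _ _ (hwv a ha))
  have htrans : ∀ a : Dᗮ, F.fiber (p + a) = F.fiber p → a = 0 := by
    intro a ha
    have h1 : (a : EuclideanSpace ℝ (Fin n)) ∈ D := by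
      have := AffineSubspace.vsub_mem_direction (ha ▸ F.mem_fiber (p + a)) (F.mem_fiber p)
      simpa using this
    have := D.inner_right_of_mem_orthogonal h1 a.2
    rw [inner_self_eq_zero] at this
    exact Subtype.ext this
  have hbdry : ∀ a ∈ sphere (0 : Dᗮ) R, ∀ s : ℝ, 0 ≤ s → v a + s • a ≠ 0 := by
    intro a ha s hs h
    have hacb := sphere_subset_closedBall ha
    suffices F.fiber (p + a) = F.fiber p by
      rw [htrans a this, mem_sphere_zero_iff_norm, norm_zero] at ha
      exact hR.ne ha
    rcases hs.eq_or_lt with rfl | hs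
    · by_contra hfib
      refine hskew _ (hloc a hacb).1 p (mem_of_mem_nhds hU) hfib
        ((containParallelLines_iff (F.mem_fiber _) (F.mem_fiber p)).2 ⟨u, hu0, ?_, hup⟩)
      have h0 : v a = 0 := by simpa using h
      simpa [h0] using hwv a hacb
    · have h1 := hmem a hacb 0 s hs (by simpa using h)
      refine F.fiber_eq_of_mem_of_mem h1 ?_
      simpa using F.add_mem_fiber p (Submodule.smul_mem _ s⁻¹ hup)
  obtain ⟨ε, hε, a, ha, h⟩ := hv.exists_add_smul_sub_eq_zero hR hbdry ⟨x - p, hxp⟩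
  have h1 := hmem a ha _ ε hε h
  have h2 : p + (x - p) + ε⁻¹ • u ∈ F.fiber x := by
    simpa using F.add_mem_fiber x (Submodule.smul_mem _ ε⁻¹ hux)
  exact (hloc a ha).2.2 (F.fiber_eq_of_mem_of_mem h1 h2 ▸ F.mem_fiber (p + a))

end PlaneFibration

theorem mainTheorem1 (n k : ℕ) (F : PlaneFibration n k) (hF : F.IsLocallySkew) :
    F.IsSkew := by
  intro x y hxy hpar
  obtain ⟨u, hu0, hux, huy⟩ :=
    (containParallelLines_iff (F.mem_fiber x) (F.mem_fiber y)).1 hpar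
  -- replace `y` by the foot on its fiber of the perpendicular from `x`
  have hp : y + (F.fiber y).direction.starProjection (x - y) ∈ F.fiber y :=
    F.add_mem_fiber y (Submodule.starProjection_apply_mem _ _)
  have hfib := F.fiber_eq_of_mem _ _ hp
  refine hxy ((hF.fiber_eq_of_sub_mem_orthogonal hu0 hux (by rwa [hfib]) ?_).trans hfib)
  rw [hfib, ← sub_sub]
  exact Submodule.sub_starProjection_mem_orthogonal _
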